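/- Let $\eta\in(0,1]$ and $\bar n_B>0$. For $N\ge 0$ let $\hat\rho_N=\sum_{k\ge 0}\frac{N^k}{(1+N)^{k+1}}|k\rangle\langle k|$ be the single-mode thermal state with mean photon number $N$ in the Fock basis. The lossy thermal-noise bosonic channel is a beamsplitter of transmittance $\eta$ with input modes $\hat a$ (Alice) and $\hat e$ (environment, in the state $\hat\rho_{\bar n_B}$) and output modes $\hat b=\sqrt{\eta}\,\hat a+\sqrt{1-\eta}\,\hat e$ (Bob) and $\hat w=\sqrt{1-\eta}\,\hat a-\sqrt{\eta}\,\hat e$ (Willie). Let Alice prepare an arbitrary qubit state with logical density matrix $$\begin{pmatrix}|\alpha|^2&\gamma\\ \gamma^*&|\beta|^2\end{pmatrix}$$ (positive semidefinite, with trace one), encode it in two optical modes by $|0\rangle_L=|01\rangle$, $|1\rangle_L=|10\rangle$, and send each of the two modes through an independent use of this channel. Then Willie's output $\hat\rho^W$, obtained by tracing out Bob's two modes, is a two-mode density operator, and its quantum $\chi^2$-divergence $D_{\chi^2}(\hat\rho\|\hat\sigma)=\operatorname{tr}[(\hat\rho-\hat\sigma)^2\hat\sigma^{-1}]$ from the two-mode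 thermal state $\hat\rho_{\eta\bar n_B}^{\otimes 2}$ exists, is finite, and satisfies $$D_{\chi^2}\left(\hat\rho^W\middle\|\hat\rho_{\eta\bar n_B}^{\otimes 2}\right)\le\frac{(1-\eta)^2}{\eta\bar n_B(1+\eta\bar n_B)},$$ with equality whenever the qubit state is pure, i.e. $|\gamma|=|\alpha|\,|\beta|$. -/

import Mathlib

open scoped ComplexOrder Kronecker ComplexConjugate

noncomputable section

namespace DualRail

/-! Operators on `ℓ²(ι)` are given by their matrices in the (Fock) basis indexed by `ι`.
For one mode `ι = ℕ` (photon numbers); for two modes `ι = ℕ × ℕ`, and `|f g⟩` is `(f, g)`. -/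

section Operators

variable {ι : Type*}

/-- The product of two operators, in matrix form. -/
def opMul {κ μ : Type*} (A : Matrix ι κ ℂ) (B : Matrix κ μ ℂ) : Matrix ι μ ℂ :=
  fun i j => ∑' k, A i k * B k j

/-- `t` is the trace of `A`, the defining series being (absolutely) convergent. -/
def HasTrace (A : Matrix ι ι ℂ) (t : ℂ) : Prop :=
  HasSum (fun i => A i i) t

/-- Density operators: positive semidefinite with trace one. -/
def IsDensity (ρ : Matrix ι ι ℂ) : Prop :=
  ρ.PosSemidef ∧ HasTrace ρ 1

/-- `B` is the inverse of `A`. The operator `B` need not be bounded. -/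
def IsInverse [DecidableEq ι] (A B : Matrix ι ι ℂ) : Prop :=
  opMul A B = 1 ∧ opMul B A = 1

/-- `d` is the quantum `χ²`-divergence `tr[(ρ - σ)² σ⁻¹]`. -/
def HasChiSqDiv [DecidableEq ι] (ρ σ : Matrix ι ι ℂ) (d : ℝ) : Prop :=
  ∃ σinv, IsInverse σ σinv ∧ HasTrace (opMul (opMul (ρ - σ) (ρ - σ)) σinv) (d : ℂ)

/-- The inverse of a diagonal operator with nonzero entries exists, is unique, and is diagonal. -/
theorem isInverse_diagonal_iff [DecidableEq ι] (s : ι → ℂ) (hs : ∀ i, s i ≠ 0)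
    (B : Matrix ι ι ℂ) :
    IsInverse (Matrix.diagonal s) B ↔ B = Matrix.diagonal fun i => (s i)⁻¹ := by
  have hl : ∀ (t : ι → ℂ) (C : Matrix ι ι ℂ) (i j : ι),
      opMul (Matrix.diagonal t) C i j = t i * C i j := by
    intro t C i j
    unfold opMul
    rw [tsum_eq_single i]
    · simp
    · intro k hk
      simp [Matrix.diagonal_apply_ne _ hk.symm]
  constructor
  · rintro ⟨h, -⟩
    ext i j
    have h' := congrFun (congrFun h i) j
    rw [hl] at h'
    rcases eq_or_ne i j with rfl | hij
    · rw [Matrix.one_apply_eq] at h'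
      rw [Matrix.diagonal_apply_eq]
      exact eq_inv_of_mul_eq_one_right h'
    · rw [Matrix.one_apply_ne hij] at h'
      rw [Matrix.diagonal_apply_ne _ hij]
      exact (mul_eq_zero.mp h').resolve_left (hs i)
  · rintro rfl
    constructor
    · ext i j
      rw [hl]
      rcases eq_or_ne i j with rfl | hij
      · simp [hs]
      · simp [hij]
    · ext i j
      rw [hl]
      rcases eq_or_ne i j with rfl | hij
      · simp [hs]
      · simp [hij]

end Operators

/-- The thermal state with mean photon number `N`. -/
def thermal (N : ℝ) : Matrix ℕ ℕ ℂ :=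
  Matrix.diagonal fun k => ((N ^ k / (1 + N) ^ (k + 1) : ℝ) : ℂ)

/-- The dual-rail basis: `|0⟩_L = |01⟩` and `|1⟩_L = |10⟩`. -/
def dualRailBasis : Fin 2 → ℕ × ℕ :=
  ![(0, 1), (1, 0)]

/-- The two-mode operator `∑ i j, ρ i j |i⟩_L ⟨j|_L` with logical matrix `ρ`. -/
def dualRail (ρ : Matrix (Fin 2) (Fin 2) ℂ) : Matrix (ℕ × ℕ) (ℕ × ℕ) ℂ :=
  fun x y => ∑ i, ∑ j, if x = dualRailBasis i ∧ y = dualRailBasis j then ρ i j else 0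

/-- The logical density matrix with rows `(|α|², γ)` and `(γ*, |β|²)`. -/
def logical (α β γ : ℂ) : Matrix (Fin 2) (Fin 2) ℂ :=
  !![((‖α‖ ^ 2 : ℝ) : ℂ), γ; conj γ, ((‖β‖ ^ 2 : ℝ) : ℂ)]

/-- The action of the beamsplitter on polynomials in the creation operators. The modal relations
`b = √η a + √(1-η) e` and `w = √(1-η) a - √η e` are equivalent to
`a† = √η b† + √(1-η) w†` and `e† = √(1-η) b† - √η w†`. On the input side the variables
`X 0, X 1` are `a†, e†`; on the output side they are `b†, w†`. -/
def modeTransform (η : ℝ) : MvPolynomial (Fin 2) ℂ →ₐ[ℂ] MvPolynomial (Fin 2) ℂ :=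
  MvPolynomial.aeval
    ![MvPolynomial.C (√η : ℂ) * MvPolynomial.X 0 + MvPolynomial.C (√(1 - η) : ℂ) * MvPolynomial.X 1,
      MvPolynomial.C (√(1 - η) : ℂ) * MvPolynomial.X 0 - MvPolynomial.C (√η : ℂ) * MvPolynomial.X 1]

/-- The beamsplitter unitary in the Fock basis: the entry at `(j, k)`, `(m, n)` is the amplitude
of `j` photons at Bob and `k` at Willie when Alice sends `m` photons and the environment `n`.
It is read off from `|m n⟩ = a†^m e†^n |00⟩ / √(m! n!)`, the mode transformation, and
`b†^j w†^k |00⟩ = √(j! k!) |j k⟩`. -/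
def beamsplitter (η : ℝ) : Matrix (ℕ × ℕ) (ℕ × ℕ) ℂ :=
  fun y x =>
    MvPolynomial.coeff (Finsupp.single 0 y.1 + Finsupp.single 1 y.2)
        (modeTransform η (MvPolynomial.X 0 ^ x.1 * MvPolynomial.X 1 ^ x.2))
      * (√((y.1.factorial * y.2.factorial : ℕ) : ℝ) : ℂ)
      / (√((x.1.factorial * x.2.factorial : ℕ) : ℝ) : ℂ)

/-- The joint input of the two channel uses, in the order `((a₁, e₁), (a₂, e₂))`: Alice's two-mode
state `ρ` together with two environment modes, each in a thermal state. -/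
def jointInput (nB : ℝ) (ρ : Matrix (ℕ × ℕ) (ℕ × ℕ) ℂ) :
    Matrix ((ℕ × ℕ) × (ℕ × ℕ)) ((ℕ × ℕ) × (ℕ × ℕ)) ℂ :=
  fun x y => ρ (x.1.1, x.2.1) (y.1.1, y.2.1)
    * (thermal nB x.1.2 y.1.2 * thermal nB x.2.2 y.2.2)

/-- The joint output of Bob and Willie, in the order `((b₁, w₁), (b₂, w₂))`: the two uses of the
beamsplitter act independently. -/
def jointOutput (η nB : ℝ) (ρ : Matrix (ℕ × ℕ) (ℕ × ℕ) ℂ) :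
    Matrix ((ℕ × ℕ) × (ℕ × ℕ)) ((ℕ × ℕ) × (ℕ × ℕ)) ℂ :=
  opMul (opMul (beamsplitter η ⊗ₖ beamsplitter η) (jointInput nB ρ))
    (beamsplitter η ⊗ₖ beamsplitter η).conjTranspose

/-- Willie's two-mode output state: the partial trace of the joint output over Bob's modes. -/
def willie (η nB : ℝ) (ρ : Matrix (ℕ × ℕ) (ℕ × ℕ) ℂ) : Matrix (ℕ × ℕ) (ℕ × ℕ) ℂ :=
  fun w w' => ∑' b : ℕ × ℕ,
    jointOutput η nB ρ ((b.1, w.1), (b.2, w.2)) ((b.1, w'.1), (b.2, w'.2))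

end DualRail

end

/-!
Write `M = η nB`. Willie's output of one channel use is linear in the input operator, so for the
dual-rail code it suffices to know the four outputs `T m m'` for the inputs `|m⟩⟨m'|` with
`m, m' ∈ {0, 1}`. The explicit beamsplitter amplitudes and negative binomial sums over Bob's photon
number (`hasSum_outputKernel_willieBlock`) give

* `T 0 0 = ρ_M`, the thermal state;
* `T 1 1`, with diagonal `ρ_M(w) (1 + (1 - η) (w - M) / (M (1 + M)))`;
* `T 1 0 = √(1 - η) / (1 + M) • a† ρ_M`, and `T 0 1` its adjoint.

Hence Willie's state is `|α|² T 0 0 ⊗ T 1 1 + |β|² T 1 1 ⊗ T 0 0 + γ T 0 1 ⊗ T 1 0 + h.c.`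
(`willie_eq`), and its deviation from `ρ_M ⊗ ρ_M` is explicit (`willie_sub_thermal`). In the trace
`tr[Δ² σ⁻¹]` the populations contribute the variances `M (1 + M)` of the photon number, and the
coherences contribute products of first moments (`hasSum_chiSq`); the result is
`(1 - η)² / (M (1 + M)) * (|α|⁴ + |β|⁴ + 2 |γ|²)`. Nonnegativity of the logical determinant says
`|γ|² ≤ |α|² |β|²`, so the last factor is at most `(|α|² + |β|²)² = 1`, with equality for pure
states.

Positivity of Willie's state holds because it is a series, over Bob's and the environment's photon
numbers, of congruences of the logical matrix (`posSemidef_willie`).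
-/

noncomputable section

namespace DualRail

/-! ### Beamsplitter amplitudes -/

theorem coeff_linear_pow (p q : ℂ) (n b w : ℕ) :
    MvPolynomial.coeff (Finsupp.single (0 : Fin 2) b + Finsupp.single 1 w)
        ((MvPolynomial.C p * MvPolynomial.X 0 + MvPolynomial.C q * MvPolynomial.X 1) ^ n) =
      if b + w = n then ((n.choose w : ℕ) : ℂ) * p ^ b * q ^ w else 0 := by
  have hmon : ∀ i j : ℕ, (MvPolynomial.C p * MvPolynomial.X (0 : Fin 2)) ^ i *
      (MvPolynomial.C q * MvPolynomial.X 1) ^ j * ((n.choose i : ℕ) : MvPolynomial (Fin 2) ℂ) =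
      MvPolynomial.monomial (Finsupp.single 0 i + Finsupp.single 1 j)
        (((n.choose i : ℕ) : ℂ) * p ^ i * q ^ j) := by
    intro i j
    have h : MvPolynomial.monomial (Finsupp.single (0 : Fin 2) i + Finsupp.single 1 j)
        (((n.choose i : ℕ) : ℂ) * p ^ i * q ^ j) =
        MvPolynomial.C (((n.choose i : ℕ) : ℂ) * p ^ i * q ^ j) * (MvPolynomial.X 0 ^ i * MvPolynomial.X 1 ^ j) := by
      simp only [MvPolynomial.X_pow_eq_monomial, MvPolynomial.monomial_mul, MvPolynomial.C_mul_monomial, mul_one]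
    rw [h]
    simp only [map_mul, map_pow, map_natCast]
    ring
  have hinj : ∀ i j : ℕ, Finsupp.single (0 : Fin 2) i + Finsupp.single 1 j =
      Finsupp.single 0 b + Finsupp.single 1 w ↔ i = b ∧ j = w := by
    intro i j
    constructor
    · intro h
      have h0 := DFunLike.congr_fun h 0
      have h1 := DFunLike.congr_fun h 1
      simp at h0 h1
      exact ⟨h0, h1⟩
    · rintro ⟨rfl, rfl⟩
      rfl
  rw [add_pow, MvPolynomial.coeff_sum]
  simp only [hmon, MvPolynomial.coeff_monomial, hinj]
  split_ifs with h
  · subst h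
    rw [Finset.sum_eq_single b]
    · simp [Nat.choose_symm_of_eq_add (rfl : b + w = b + w)]
    · intro i _ hi
      simp [hi]
    · simp
  · refine Finset.sum_eq_zero fun i hi => if_neg ?_
    rintro ⟨rfl, rfl⟩
    have := Finset.mem_range.mp hi
    omega

theorem modeTransform_monomial (η : ℝ) (m n : ℕ) :
    modeTransform η (MvPolynomial.X 0 ^ m * MvPolynomial.X 1 ^ n) =
      (MvPolynomial.C (√η : ℂ) * MvPolynomial.X 0 +
          MvPolynomial.C (√(1 - η) : ℂ) * MvPolynomial.X 1) ^ m *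
        (MvPolynomial.C (√(1 - η) : ℂ) * MvPolynomial.X 0 +
          MvPolynomial.C (-√η : ℂ) * MvPolynomial.X 1) ^ n := by
  simp [modeTransform, sub_eq_add_neg]

/-- The beamsplitter conserves the total photon number, because the mode transformation is linear
and hence preserves the degree. -/
theorem beamsplitter_eq_zero (η : ℝ) {x y : ℕ × ℕ} (h : y.1 + y.2 ≠ x.1 + x.2) :
    beamsplitter η y x = 0 := by
  have hlin : ∀ p q : ℂ, (MvPolynomial.C p * MvPolynomial.X (0 : Fin 2) +
      MvPolynomial.C q * MvPolynomial.X 1).IsHomogeneous 1 := fun p q => by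
    have h := ((MvPolynomial.isHomogeneous_C (Fin 2) p).mul (MvPolynomial.isHomogeneous_X ℂ 0)).add
      ((MvPolynomial.isHomogeneous_C (Fin 2) q).mul (MvPolynomial.isHomogeneous_X ℂ 1))
    simpa using h
  unfold beamsplitter
  rw [modeTransform_monomial,
    (((hlin _ _).pow x.1).mul ((hlin _ _).pow x.2)).coeff_eq_zero (by simpa using h)]
  simp

theorem coeff_linear_mul (p q : ℂ) (b w : ℕ) (P : MvPolynomial (Fin 2) ℂ) :
    MvPolynomial.coeff (Finsupp.single (0 : Fin 2) b + Finsupp.single 1 w)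
        ((MvPolynomial.C p * MvPolynomial.X 0 + MvPolynomial.C q * MvPolynomial.X 1) * P) =
      (if b = 0 then 0 else
        p * MvPolynomial.coeff (Finsupp.single (0 : Fin 2) (b - 1) + Finsupp.single 1 w) P) +
      (if w = 0 then 0 else
        q * MvPolynomial.coeff (Finsupp.single (0 : Fin 2) b + Finsupp.single 1 (w - 1)) P) := by
  have h0 : Finsupp.single (0 : Fin 2) b + Finsupp.single 1 w - Finsupp.single 0 1 =
      Finsupp.single (0 : Fin 2) (b - 1) + Finsupp.single 1 w := by
    ext i; fin_cases i <;> simp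
  have h1 : Finsupp.single (0 : Fin 2) b + Finsupp.single 1 w - Finsupp.single 1 1 =
      Finsupp.single (0 : Fin 2) b + Finsupp.single 1 (w - 1) := by
    ext i; fin_cases i <;> simp
  rw [add_mul, MvPolynomial.coeff_add, mul_assoc, mul_assoc, MvPolynomial.coeff_C_mul,
    MvPolynomial.coeff_C_mul, MvPolynomial.coeff_X_mul', MvPolynomial.coeff_X_mul', h0, h1]
  simp [Finsupp.mem_support_iff, mul_ite]

/-- The Fock normalisation turns a binomial coefficient into its square root. -/
theorem choose_mul_sqrt_factorial (b w : ℕ) :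
    ((b + w).choose w : ℝ) * √((b.factorial * w.factorial : ℕ) : ℝ) / √((b + w).factorial : ℝ) =
      √((b + w).choose w : ℝ) := by
  have h : (((b + w).factorial : ℕ) : ℝ) = (b + w).choose w * ((b.factorial * w.factorial : ℕ) : ℝ) := by
    rw [← Nat.add_choose_mul_factorial_mul_factorial b w]
    push_cast; ring
  have hf : 0 < ((b.factorial * w.factorial : ℕ) : ℝ) := by positivity
  have hc : 0 < ((b + w).choose w : ℝ) := by
    exact_mod_cast Nat.choose_pos (Nat.le_add_left w b)
  rw [h, Real.sqrt_mul hc.le, div_eq_iff (by positivity)]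
  nth_rewrite 1 [← Real.mul_self_sqrt hc.le]
  ring

theorem beamsplitter_zero (η : ℝ) (b w : ℕ) :
    beamsplitter η (b, w) (0, b + w) =
        ((√((b + w).choose w : ℝ) * √(1 - η) ^ b * (-√η) ^ w : ℝ) : ℂ) := by
  unfold beamsplitter
  rw [modeTransform_monomial, pow_zero, one_mul, coeff_linear_pow, if_pos rfl,
    ← choose_mul_sqrt_factorial]
  simp only [Nat.factorial_zero, one_mul]
  push_cast
  ring

/-- The amplitude with one photon at Alice is the interference of two terms: her photon reaches
Willie, or it reaches Bob. They share the binomial factor. For `b = 0` the truncated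
exponent `b - 1` is harmless, since its factor `b` vanishes. -/
theorem beamsplitter_one_succ (η : ℝ) (b v : ℕ) :
    beamsplitter η (b, v + 1) (1, b + v) =
      ((√((b + v).choose v : ℝ) * (-√η) ^ v *
        (√(1 - η) ^ (b + 1) * √(v + 1 : ℝ)
          - √η ^ 2 * (b * √(1 - η) ^ (b - 1)) / √(v + 1 : ℝ)) : ℝ) : ℂ) := by
  have hv : (0 : ℝ) < v + 1 := by positivity
  have hc : ((b + v).choose (v + 1) : ℝ) = (b + v).choose v * b / (v + 1) := by
    rw [eq_div_iff hv.ne']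
    have := Nat.choose_succ_right_eq (b + v) v
    rw [Nat.add_sub_cancel] at this
    exact_mod_cast this
  unfold beamsplitter
  rw [modeTransform_monomial, pow_one, coeff_linear_mul, coeff_linear_pow, coeff_linear_pow,
    ← choose_mul_sqrt_factorial]
  have hf : √((b.factorial * (v + 1).factorial : ℕ) : ℝ) =
      √(v + 1 : ℝ) * √((b.factorial * v.factorial : ℕ) : ℝ) := by
    rw [← Real.sqrt_mul hv.le, Nat.factorial_succ]
    push_cast
    congr 1
    ring
  have hs : (√(v + 1 : ℝ)) ^ 2 = v + 1 := Real.sq_sqrt hv.le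
  have hs0 : √(v + 1 : ℝ) ≠ 0 := (Real.sqrt_pos.mpr hv).ne'
  simp only [Nat.factorial_one, one_mul, Nat.add_sub_cancel, if_true, Nat.succ_ne_zero, if_false, hf]
  rcases b with - | b
  · simp
    ring
  · simp only [Nat.succ_ne_zero, if_false, Nat.add_sub_cancel]
    rw [if_pos (by omega), ← Complex.ofReal_natCast ((b + 1 + v).choose (v + 1)), hc]
    norm_cast
    push_cast
    generalize √(v + 1 : ℝ) = r at hs hs0 ⊢
    rw [← hs]
    field_simp
    ring

theorem beamsplitter_one_zero (η : ℝ) (b : ℕ) :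
    beamsplitter η (b + 1, 0) (1, b) = ((√η * √(b + 1 : ℝ) * √(1 - η) ^ b : ℝ) : ℂ) := by
  unfold beamsplitter
  rw [modeTransform_monomial, pow_one, coeff_linear_mul, coeff_linear_pow]
  have hf : √(((b + 1).factorial : ℕ) : ℝ) = √(b + 1 : ℝ) * √(b.factorial : ℝ) := by
    rw [← Real.sqrt_mul (by positivity), Nat.factorial_succ]
    push_cast
    rfl
  have hs0 : √(b.factorial : ℝ) ≠ 0 := (Real.sqrt_pos.mpr (by positivity)).ne'
  simp [hf]
  have : (√(b.factorial : ℝ) : ℂ) ≠ 0 := by exact_mod_cast hs0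
  field_simp

/-! ### The joint output -/

/-- The photon-number distribution of the thermal state with mean photon number `N`. -/
def thermalWeight (N : ℝ) (k : ℕ) : ℝ :=
  N ^ k / (1 + N) ^ (k + 1)

theorem thermal_apply (N : ℝ) (k l : ℕ) :
    thermal N k l = if k = l then (thermalWeight N k : ℂ) else 0 := by
  simp [thermal, Matrix.diagonal_apply, thermalWeight]

theorem hasSum_prod_mul {𝕜 ι κ : Type*} [RCLike 𝕜] {f : ι → 𝕜} {g : κ → 𝕜} {a b : 𝕜} (hf : HasSum f a)
    (hg : HasSum g b) : HasSum (fun x : ι × κ => f x.1 * g x.2) (a * b) :=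
  hf.mul hg (summable_mul_of_summable_norm hf.summable.norm hg.summable.norm)

/-- The matrix element `⟨y| U (|m⟩⟨m'| ⊗ ρ_N) U† |y'⟩` of the joint output of one channel use. -/
def outputKernel (η nB : ℝ) (m m' : ℕ) (y y' : ℕ × ℕ) : ℂ :=
  ∑' n, (thermalWeight nB n : ℂ) * beamsplitter η y (m, n) * conj (beamsplitter η y' (m', n))

theorem hasSum_outputKernel (η nB : ℝ) (m m' : ℕ) (y y' : ℕ × ℕ) :
    HasSum (fun n => (thermalWeight nB n : ℂ) * beamsplitter η y (m, n) *
      conj (beamsplitter η y' (m', n))) (outputKernel η nB m m' y y') := by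
  refine (summable_of_ne_finset_zero (s := {y.1 + y.2 - m}) fun n hn => ?_).hasSum
  rw [beamsplitter_eq_zero η (x := (m, n)) (y := y), mul_zero, zero_mul]
  simp only [Finset.mem_singleton] at hn
  intro h
  simp only at h
  omega

theorem outputKernel_eq (η nB : ℝ) {m m' n : ℕ} {y y' : ℕ × ℕ} (h : y.1 + y.2 = m + n) :
    outputKernel η nB m m' y y' =
      (thermalWeight nB n : ℂ) * beamsplitter η y (m, n) * conj (beamsplitter η y' (m', n)) := by
  refine tsum_eq_single n fun k hk => ?_
  rw [beamsplitter_eq_zero η (x := (m, k)) (y := y), mul_zero, zero_mul]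
  simp only
  omega

/-- Both sides of the kernel must arise from the same environment photon number `n`. -/
theorem outputKernel_eq_zero (η nB : ℝ) {m m' : ℕ} {y y' : ℕ × ℕ}
    (h : ∀ n, y.1 + y.2 = m + n → y'.1 + y'.2 ≠ m' + n) :
    outputKernel η nB m m' y y' = 0 := by
  unfold outputKernel
  rw [tsum_congr (g := fun _ => (0 : ℂ)), tsum_zero]
  intro n
  by_cases hy : y.1 + y.2 = m + n
  · rw [beamsplitter_eq_zero η (x := (m', n)) (y := y') (h n hy), map_zero, mul_zero]
  · rw [beamsplitter_eq_zero η (x := (m, n)) (y := y) hy, mul_zero, zero_mul]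

/-- The input basis vector carrying the logical state `i` and the environment photon numbers `n`. -/
def inputIndex (i : Fin 2) (n : ℕ × ℕ) : (ℕ × ℕ) × (ℕ × ℕ) :=
  (((dualRailBasis i).1, n.1), ((dualRailBasis i).2, n.2))

theorem inputIndex_injective (i : Fin 2) : Function.Injective (inputIndex i) := by
  rintro ⟨a, b⟩ ⟨c, d⟩ h
  simp only [inputIndex, Prod.mk.injEq] at h
  exact Prod.ext h.1.2 h.2.2

theorem jointInput_dualRail (nB : ℝ) (ρ : Matrix (Fin 2) (Fin 2) ℂ)
    (x k : (ℕ × ℕ) × (ℕ × ℕ)) :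
    jointInput nB (dualRail ρ) x k =
      ∑ i, ∑ j, if x = inputIndex i (k.1.2, k.2.2) then
        if k = inputIndex j (k.1.2, k.2.2) then
          ρ i j * ((thermalWeight nB k.1.2 : ℂ) * thermalWeight nB k.2.2) else 0 else 0 := by
  obtain ⟨⟨m₁, n₁⟩, ⟨m₂, n₂⟩⟩ := x
  obtain ⟨⟨m₁', n₁'⟩, ⟨m₂', n₂'⟩⟩ := k
  unfold jointInput dualRail
  rw [Finset.sum_mul]
  refine Finset.sum_congr rfl fun i _ => ?_
  rw [Finset.sum_mul]
  refine Finset.sum_congr rfl fun j _ => ?_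
  simp only [thermal_apply, inputIndex, Prod.ext_iff, and_true]
  by_cases h1 : n₁ = n₁' <;> by_cases h2 : n₂ = n₂' <;> simp [h1, h2, ite_and]

/-- The joint output in two forms: as a mixture, over the environment photon numbers `n`, of
congruences `G ρ Gᴴ` of the logical matrix, which shows positivity; and as a combination of products
of one-mode kernels, which makes it computable. -/
theorem jointOutput_dualRail (η nB : ℝ) (ρ : Matrix (Fin 2) (Fin 2) ℂ)
    (y y' : (ℕ × ℕ) × (ℕ × ℕ)) :
    HasSum (fun n : ℕ × ℕ => ((thermalWeight nB n.1 * thermalWeight nB n.2 : ℝ) : ℂ) *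
        ∑ i, ∑ j, (beamsplitter η ⊗ₖ beamsplitter η) y (inputIndex i n) * ρ i j *
          conj ((beamsplitter η ⊗ₖ beamsplitter η) y' (inputIndex j n)))
      (jointOutput η nB (dualRail ρ) y y') ∧
    jointOutput η nB (dualRail ρ) y y' = ∑ i, ∑ j, ρ i j *
      (outputKernel η nB (dualRailBasis i).1 (dualRailBasis j).1 y.1 y'.1 *
        outputKernel η nB (dualRailBasis i).2 (dualRailBasis j).2 y.2 y'.2) := by
  set U := beamsplitter η ⊗ₖ beamsplitter η with hU
  have inner : ∀ k, opMul U (jointInput nB (dualRail ρ)) y k =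
      ∑ i, ∑ j, if k = inputIndex j (k.1.2, k.2.2) then U y (inputIndex i (k.1.2, k.2.2)) *
          (ρ i j * ((thermalWeight nB k.1.2 : ℂ) * thermalWeight nB k.2.2)) else 0 := by
    intro k
    -- The environment is diagonal, so for given `k` only one row contributes for each `i`.
    refine HasSum.tsum_eq ?_
    simp only [jointInput_dualRail, Finset.mul_sum]
    refine hasSum_sum fun i _ => hasSum_sum fun j _ => ?_
    have h := hasSum_single (inputIndex i (k.1.2, k.2.2)) (f := fun x => U y x *
      if x = inputIndex i (k.1.2, k.2.2) then
        if k = inputIndex j (k.1.2, k.2.2) then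
          ρ i j * ((thermalWeight nB k.1.2 : ℂ) * thermalWeight nB k.2.2) else 0 else 0)
      fun x hx => by rw [if_neg hx, mul_zero]
    rwa [if_pos rfl, mul_ite, mul_zero] at h
  have term : ∀ i j, HasSum (fun n : ℕ × ℕ => U y (inputIndex i n) *
      (ρ i j * ((thermalWeight nB n.1 : ℂ) * thermalWeight nB n.2)) *
        conj (U y' (inputIndex j n)))
      (ρ i j *
      (outputKernel η nB (dualRailBasis i).1 (dualRailBasis j).1 y.1 y'.1 *
        outputKernel η nB (dualRailBasis i).2 (dualRailBasis j).2 y.2 y'.2)) := by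
    intro i j
    have h := (hasSum_prod_mul
      (hasSum_outputKernel η nB (dualRailBasis i).1 (dualRailBasis j).1 y.1 y'.1)
      (hasSum_outputKernel η nB (dualRailBasis i).2 (dualRailBasis j).2 y.2 y'.2)).mul_left (ρ i j)
    refine h.congr_fun fun n => ?_
    simp only [hU, Matrix.kroneckerMap_apply, inputIndex, map_mul]
    ring
  have total : jointOutput η nB (dualRail ρ) y y' = ∑ i, ∑ j, ρ i j *
      (outputKernel η nB (dualRailBasis i).1 (dualRailBasis j).1 y.1 y'.1 *
        outputKernel η nB (dualRailBasis i).2 (dualRailBasis j).2 y.2 y'.2) := by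
    refine HasSum.tsum_eq ?_
    simp only [← hU, inner, Finset.sum_mul]
    refine hasSum_sum fun i _ => hasSum_sum fun j _ => ?_
    refine ((inputIndex_injective j).hasSum_iff ?_).mp ?_
    · intro k hk
      rw [if_neg fun h => hk ⟨_, h.symm⟩, zero_mul]
    · convert term i j using 2 with n
      simp [inputIndex, Matrix.conjTranspose_apply]
  refine ⟨?_, total⟩
  rw [total]
  convert hasSum_sum fun i _ => hasSum_sum fun j _ => term i j using 2 with n
  rw [Finset.mul_sum]
  refine Finset.sum_congr rfl fun i _ => ?_
  rw [Finset.mul_sum]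
  refine Finset.sum_congr rfl fun j _ => ?_
  push_cast
  ring

/-- Positive semidefiniteness passes to entrywise sums of series. -/
theorem posSemidef_of_hasSum {ι κ : Type*} {A : κ → Matrix ι ι ℂ} {B : Matrix ι ι ℂ}
    (hA : ∀ k, (A k).PosSemidef) (hB : ∀ i j, HasSum (fun k => A k i j) (B i j)) :
    B.PosSemidef := by
  constructor
  · ext i j
    have h := (hB j i).star
    refine h.unique ?_
    convert hB i j using 2 with k
    exact (hA k).1.apply i j
  · intro x
    have h : HasSum (fun k => x.sum fun i xi => x.sum fun j xj => star xi * A k i j * xj)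
        (x.sum fun i xi => x.sum fun j xj => star xi * B i j * xj) :=
      hasSum_sum fun i _ => hasSum_sum fun j _ => ((hB i j).mul_left _).mul_right _
    exact h.nonneg fun k => (hA k).2 x

/-! ### Partial trace over Bob's modes -/

theorem hasSum_choose_mul_pow (w : ℕ) {r : ℝ} (hr0 : 0 ≤ r) (hr1 : r < 1) :
    HasSum (fun b : ℕ => ((b + w).choose w : ℝ) * r ^ b) (1 / (1 - r) ^ (w + 1)) :=
  hasSum_choose_mul_geometric_of_norm_lt_one w (by rwa [Real.norm_of_nonneg hr0])

/-- The absorption identity that turns the weights `b` and `b ^ 2` of a negative binomial series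
into series with a larger lower index. -/
theorem succ_mul_choose (b w : ℕ) :
    ((b + 1 : ℕ) : ℝ) * ((b + 1 + w).choose w : ℝ) =
      (w + 1) * ((b + (w + 1)).choose (w + 1) : ℝ) := by
  have h := Nat.choose_succ_right_eq (b + 1 + w) w
  rw [Nat.add_sub_cancel] at h
  have h' : (b + 1) * (b + 1 + w).choose w = (w + 1) * (b + (w + 1)).choose (w + 1) := by
    rw [show b + (w + 1) = b + 1 + w by ring, mul_comm, ← h, mul_comm]
  exact_mod_cast h'

theorem hasSum_mul_choose_mul_pow (w : ℕ) {r : ℝ} (hr0 : 0 ≤ r) (hr1 : r < 1) :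
    HasSum (fun b : ℕ => (b : ℝ) * ((b + w).choose w : ℝ) * r ^ (b - 1))
      ((w + 1) / (1 - r) ^ (w + 2)) := by
  -- The term `b = 0`, with its truncated exponent, vanishes.
  rw [← hasSum_nat_add_iff' 1]
  have h := (hasSum_choose_mul_pow (w + 1) hr0 hr1).mul_left ((w : ℝ) + 1)
  simp only [Finset.sum_range_one, Nat.cast_zero, zero_mul, sub_zero]
  rw [mul_one_div] at h
  refine h.congr_fun fun b => ?_
  rw [succ_mul_choose, Nat.add_sub_cancel, mul_assoc]

theorem hasSum_sq_mul_choose_mul_pow (w : ℕ) {r : ℝ} (hr0 : 0 ≤ r) (hr1 : r < 1) :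
    HasSum (fun b : ℕ => (b : ℝ) ^ 2 * ((b + w).choose w : ℝ) * r ^ (b - 1))
      ((w + 1) * (1 / (1 - r) ^ (w + 2) + r * ((w + 2) / (1 - r) ^ (w + 3)))) := by
  rw [← hasSum_nat_add_iff' 1]
  have h := (((hasSum_choose_mul_pow (w + 1) hr0 hr1).add
    ((hasSum_mul_choose_mul_pow (w + 1) hr0 hr1).mul_left r))).mul_left ((w : ℝ) + 1)
  simp only [Finset.sum_range_one, Nat.cast_zero, zero_mul, sub_zero, ne_eq, OfNat.ofNat_ne_zero,
    not_false_eq_true, zero_pow]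
  have hval : ((w : ℝ) + 1) * (1 / (1 - r) ^ (w + 2) + r * ((w + 2) / (1 - r) ^ (w + 3))) =
      (w + 1) * (1 / (1 - r) ^ (w + 1 + 1) +
        r * (((w + 1 : ℕ) + 1) / (1 - r) ^ (w + 1 + 2))) := by
    push_cast
    ring
  rw [hval]
  refine h.congr_fun fun b => ?_
  rw [pow_two, mul_assoc ((b + 1 : ℕ) : ℝ), succ_mul_choose, Nat.add_sub_cancel]
  rcases b with - | b
  · simp
  · push_cast
    rw [pow_succ]
    ring

/-- One minus the ratio of the geometric series over Bob's photon number. -/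
theorem one_sub_ratio {η nB : ℝ} (hnB : 0 < nB) :
    1 - nB / (1 + nB) * (1 - η) = (1 + η * nB) / (1 + nB) := by
  have : 1 + nB ≠ 0 := by positivity
  field_simp
  ring

theorem ratio_nonneg {η nB : ℝ} (hη1 : η ≤ 1) (hnB : 0 < nB) : 0 ≤ nB / (1 + nB) * (1 - η) :=
  mul_nonneg (by positivity) (by linarith)

theorem ratio_lt_one {η nB : ℝ} (hη0 : 0 < η) (hnB : 0 < nB) : nB / (1 + nB) * (1 - η) < 1 := by
  have h : 0 < (1 + η * nB) / (1 + nB) := by positivity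
  rw [← one_sub_ratio hnB] at h
  linarith

theorem thermalWeight_add (N : ℝ) (b w : ℕ) :
    thermalWeight N (b + w) = (N / (1 + N)) ^ b * ((N / (1 + N)) ^ w / (1 + N)) := by
  unfold thermalWeight
  generalize 1 + N = D
  rw [pow_succ, pow_add, pow_add, div_pow, div_pow]
  ring

theorem thermalWeight_mul_eq {η nB : ℝ} (hη0 : 0 < η) (hnB : 0 < nB) (w : ℕ) :
    (nB / (1 + nB)) ^ w / (1 + nB) * η ^ w * (1 / ((1 + η * nB) / (1 + nB)) ^ (w + 1)) =
      thermalWeight (η * nB) w := by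
  have h1 : 1 + nB ≠ 0 := by positivity
  have h2 : 1 + η * nB ≠ 0 := by positivity
  unfold thermalWeight
  rw [div_pow, div_pow, mul_pow]
  field_simp
  ring

/-- Vacuum at Alice leaves Willie with a thermal state of mean photon number `η nB`. -/
theorem hasSum_outputKernel_zero_zero {η nB : ℝ} (hη0 : 0 < η) (hη1 : η ≤ 1) (hnB : 0 < nB)
    (w w' : ℕ) :
    HasSum (fun b => outputKernel η nB 0 0 (b, w) (b, w'))
      (((if w = w' then thermalWeight (η * nB) w else 0 : ℝ)) : ℂ) := by
  split_ifs with h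
  · subst h
    have hs := (hasSum_choose_mul_pow w (ratio_nonneg hη1 hnB) (ratio_lt_one hη0 hnB)).mul_left
      ((nB / (1 + nB)) ^ w / (1 + nB) * η ^ w)
    rw [one_sub_ratio hnB, thermalWeight_mul_eq hη0 hnB, ← Complex.hasSum_ofReal] at hs
    refine hs.congr_fun fun b => ?_
    rw [outputKernel_eq η nB (n := b + w) (by simp), beamsplitter_zero, Complex.conj_ofReal]
    norm_cast
    have h1 : √η ^ 2 = η := Real.sq_sqrt hη0.le
    have h2 : √(1 - η) ^ 2 = 1 - η := Real.sq_sqrt (by linarith)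
    have h3 : √((b + w).choose w : ℝ) ^ 2 = (b + w).choose w := Real.sq_sqrt (by positivity)
    have h4 : ((-√η) ^ w) ^ 2 = η ^ w := by rw [← pow_mul, mul_comm, pow_mul, neg_sq, h1]
    have h5 : (√(1 - η) ^ b) ^ 2 = (1 - η) ^ b := by rw [← pow_mul, mul_comm, pow_mul, h2]
    generalize √((b + w).choose w : ℝ) = c at h3 ⊢
    rw [thermalWeight_add, mul_pow, ← h3, ← h4, ← h5]
    ring
  · convert hasSum_zero using 2 with b
    · refine outputKernel_eq_zero η nB fun n h1 h2 => h ?_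
      simp only at h1 h2
      omega
    · simp

theorem ofReal_outputKernel_one_zero (η nB : ℝ) (hη0 : 0 < η) (hη1 : η ≤ 1) (b w : ℕ) :
    outputKernel η nB 1 0 (b, w + 1) (b, w) =
      (((nB / (1 + nB)) ^ w / (1 + nB) * η ^ w * √(1 - η) *
        (√(w + 1 : ℝ) * (((b + w).choose w : ℝ) * (nB / (1 + nB) * (1 - η)) ^ b) -
          η * (nB / (1 + nB)) / √(w + 1 : ℝ) *
            (b * ((b + w).choose w : ℝ) * (nB / (1 + nB) * (1 - η)) ^ (b - 1))) : ℝ) : ℂ) := by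
  rw [outputKernel_eq η nB (n := b + w) (by simp; ring), beamsplitter_zero, beamsplitter_one_succ,
    Complex.conj_ofReal]
  norm_cast
  have h1 : √η ^ 2 = η := Real.sq_sqrt hη0.le
  have h2 : √(1 - η) ^ 2 = 1 - η := Real.sq_sqrt (by linarith)
  have h3 : √((b + w).choose w : ℝ) ^ 2 = (b + w).choose w := Real.sq_sqrt (by positivity)
  have h4 : ((-√η) ^ w) ^ 2 = η ^ w := by rw [← pow_mul, mul_comm, pow_mul, neg_sq, h1]
  have h5 : ∀ b, (√(1 - η) ^ b) ^ 2 = (1 - η) ^ b := fun b => by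
    rw [← pow_mul, mul_comm, pow_mul, h2]
  generalize √((b + w).choose w : ℝ) = c at h3 ⊢
  push_cast
  rw [thermalWeight_add, mul_pow, mul_pow, ← h3, ← h4, ← h5, ← h5, h1]
  rcases b with - | b
  · simp
    ring
  · rw [Nat.add_sub_cancel]
    ring

theorem outputKernel_zero_one (η nB : ℝ) (b w : ℕ) :
    outputKernel η nB 0 1 (b, w) (b, w + 1) = outputKernel η nB 1 0 (b, w + 1) (b, w) := by
  rw [outputKernel_eq η nB (n := b + w) (by simp), outputKernel_eq η nB (n := b + w) (by simp; ring),
    beamsplitter_zero, beamsplitter_one_succ, Complex.conj_ofReal, Complex.conj_ofReal]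
  ring

/-- The entry at `(w + 1, w)` of Willie's output for the input operator `|1⟩⟨0|`. With
`M = η nB` and Willie's creation operator `a†`, this output is `√(1 - η) / (1 + M) • a† ρ_M`. -/
def coherence (η nB : ℝ) (w : ℕ) : ℝ :=
  √(1 - η) / (1 + η * nB) * √(w + 1 : ℝ) * thermalWeight (η * nB) w

theorem hasSum_outputKernel_one_zero_succ {η nB : ℝ} (hη0 : 0 < η) (hη1 : η ≤ 1) (hnB : 0 < nB)
    (w : ℕ) :
    HasSum (fun b => outputKernel η nB 1 0 (b, w + 1) (b, w)) (coherence η nB w : ℂ) := by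
  simp only [ofReal_outputKernel_one_zero η nB hη0 hη1]
  rw [Complex.hasSum_ofReal]
  have hr0 := ratio_nonneg hη1 hnB
  have hr1 := ratio_lt_one hη0 hnB
  have hs := ((((hasSum_choose_mul_pow w hr0 hr1).mul_left √(w + 1 : ℝ)).sub
    ((hasSum_mul_choose_mul_pow w hr0 hr1).mul_left (η * (nB / (1 + nB)) / √(w + 1 : ℝ)))).mul_left
      ((nB / (1 + nB)) ^ w / (1 + nB) * η ^ w * √(1 - η)))
  refine (?_ : _ = coherence η nB w) ▸ hs
  have h1 : 1 + nB ≠ 0 := by positivity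
  have h2 : 1 + η * nB ≠ 0 := by positivity
  have hw : √(w + 1 : ℝ) ^ 2 = w + 1 := Real.sq_sqrt (by positivity)
  have hw0 : √(w + 1 : ℝ) ≠ 0 := (Real.sqrt_pos.mpr (by positivity)).ne'
  rw [coherence, one_sub_ratio hnB, ← thermalWeight_mul_eq hη0 hnB]
  generalize √(w + 1 : ℝ) = r at hw hw0 ⊢
  rw [← hw, pow_succ _ (w + 1)]
  field_simp
  ring

/-- The diagonal entries of Willie's output when Alice sends one photon: with `M = η nB`, the
thermal weight is tilted by the affine factor `1 + (1 - η) (w - M) / (M (1 + M))`. -/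
def onePhotonWeight (η nB : ℝ) (w : ℕ) : ℝ :=
  thermalWeight (η * nB) w * (1 + (1 - η) / (η * nB * (1 + η * nB)) * (w - η * nB))

theorem hasSum_outputKernel_one_one_self {η nB : ℝ} (hη0 : 0 < η) (hη1 : η ≤ 1) (hnB : 0 < nB)
    (w : ℕ) :
    HasSum (fun b => outputKernel η nB 1 1 (b, w) (b, w)) (onePhotonWeight η nB w : ℂ) := by
  have hr0 := ratio_nonneg hη1 hnB
  have hr1 := ratio_lt_one hη0 hnB
  have e1 : √η ^ 2 = η := Real.sq_sqrt hη0.le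
  have e2 : √(1 - η) ^ 2 = 1 - η := Real.sq_sqrt (by linarith)
  have e5 : ∀ b, (√(1 - η) ^ b) ^ 2 = (1 - η) ^ b := fun b => by
    rw [← pow_mul, mul_comm, pow_mul, e2]
  have h1 : 1 + nB ≠ 0 := by positivity
  have h2 : 1 + η * nB ≠ 0 := by positivity
  -- For `w = 0` the photon must reach Bob; otherwise the two terms of the amplitude interfere.
  rcases w with - | v
  · have h00 : outputKernel η nB 1 1 (0, 0) (0, 0) = 0 :=
      outputKernel_eq_zero η nB fun n hn => by simp at hn; omega
    rw [← hasSum_nat_add_iff' 1, Finset.sum_range_one, h00, sub_zero]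
    have hs := (hasSum_choose_mul_pow 1 hr0 hr1).mul_left (η / (1 + nB))
    have hval : onePhotonWeight η nB 0 = η / (1 + nB) *
        (1 / (1 - nB / (1 + nB) * (1 - η)) ^ (1 + 1)) := by
      rw [one_sub_ratio hnB, onePhotonWeight, thermalWeight, one_add_one_eq_two]
      field_simp
      push_cast
      ring
    rw [← hval, ← Complex.hasSum_ofReal] at hs
    refine hs.congr_fun fun b => ?_
    · rw [outputKernel_eq η nB (n := b) (by simp; ring), beamsplitter_one_zero,
        Complex.conj_ofReal]
      norm_cast
      have e3 : √((b + 1 : ℕ) : ℝ) ^ 2 = ((b + 1 : ℕ) : ℝ) := Real.sq_sqrt (by positivity)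
      have e6 := thermalWeight_add nB b 0
      rw [add_zero, pow_zero] at e6
      rw [e6, Nat.choose_one_right, mul_pow, ← e5]
      generalize √(1 - η) = s
      generalize √((b + 1 : ℕ) : ℝ) = c at e3 ⊢
      generalize √η = t at e1 ⊢
      rw [← e3, ← e1]
      ring
  · have hs := ((((hasSum_choose_mul_pow v hr0 hr1).mul_left ((v + 1) * (1 - η))).sub
      ((hasSum_mul_choose_mul_pow v hr0 hr1).mul_left (2 * η * (1 - η) * (nB / (1 + nB))))).add
      ((hasSum_sq_mul_choose_mul_pow v hr0 hr1).mul_left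
        (η ^ 2 * (nB / (1 + nB)) / (v + 1)))).mul_left ((nB / (1 + nB)) ^ v / (1 + nB) * η ^ v)
    have hval : (nB / (1 + nB)) ^ v / (1 + nB) * η ^ v *
        ((v + 1) * (1 - η) * (1 / (1 - nB / (1 + nB) * (1 - η)) ^ (v + 1)) -
          2 * η * (1 - η) * (nB / (1 + nB)) *
            ((v + 1) / (1 - nB / (1 + nB) * (1 - η)) ^ (v + 2)) +
          η ^ 2 * (nB / (1 + nB)) / (v + 1) *
            ((v + 1) * (1 / (1 - nB / (1 + nB) * (1 - η)) ^ (v + 2) +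
              nB / (1 + nB) * (1 - η) *
                ((v + 2) / (1 - nB / (1 + nB) * (1 - η)) ^ (v + 3))))) =
        onePhotonWeight η nB (v + 1) := by
      have e7 := thermalWeight_mul_eq hη0 hnB v
      have e8 : thermalWeight (η * nB) (v + 1) =
          thermalWeight (η * nB) v * (η * nB / (1 + η * nB)) := by
        unfold thermalWeight
        rw [pow_succ, pow_succ _ (v + 1)]
        field_simp
      rw [one_sub_ratio hnB, onePhotonWeight, e8, ← e7, pow_succ _ (v + 2), pow_succ _ (v + 1)]
      push_cast
      field_simp
      ring
    rw [hval, ← Complex.hasSum_ofReal] at hs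
    refine hs.congr_fun fun b => ?_
    rw [outputKernel_eq η nB (n := b + v) (by simp; ring), beamsplitter_one_succ,
      Complex.conj_ofReal]
    norm_cast
    have e3 : √((b + v).choose v : ℝ) ^ 2 = (b + v).choose v := Real.sq_sqrt (by positivity)
    have e4 : ((-√η) ^ v) ^ 2 = η ^ v := by rw [← pow_mul, mul_comm, pow_mul, neg_sq, e1]
    have hv : √(v + 1 : ℝ) ^ 2 = v + 1 := Real.sq_sqrt (by positivity)
    have hv0 : √(v + 1 : ℝ) ≠ 0 := (Real.sqrt_pos.mpr (by positivity)).ne'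
    push_cast
    generalize √((b + v).choose v : ℝ) = c at e3 ⊢
    rw [thermalWeight_add, mul_pow, mul_pow, ← e3, ← e4, ← e5, ← e5, e1]
    generalize √(v + 1 : ℝ) = r at hv hv0 ⊢
    generalize √(1 - η) = s at e2 ⊢
    generalize nB / (1 + nB) = q
    rw [← hv, ← e2]
    rcases b with - | b
    · simp
      ring
    · rw [Nat.add_sub_cancel]
      field_simp
      ring

/-! ### Willie's output state -/

/-- Willie's output for the input operator `|m⟩⟨m'|` of one channel use, where `m, m' ≤ 1`. It
changes Willie's photon number by `m - m'`. -/
def willieBlock (η nB : ℝ) (m m' : ℕ) : Matrix ℕ ℕ ℝ := fun w w' =>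
  if w + m' = w' + m then
    if m = 0 then
      if m' = 0 then thermalWeight (η * nB) w else coherence η nB w
    else
      if m' = 0 then coherence η nB w' else onePhotonWeight η nB w
  else 0

theorem hasSum_outputKernel_willieBlock {η nB : ℝ} (hη0 : 0 < η) (hη1 : η ≤ 1) (hnB : 0 < nB)
    {m m' : ℕ} (hm : m ≤ 1) (hm' : m' ≤ 1) (w w' : ℕ) :
    HasSum (fun b => outputKernel η nB m m' (b, w) (b, w'))
      (willieBlock η nB m m' w w' : ℂ) := by
  have zero : w + m' ≠ w' + m → HasSum (fun b => outputKernel η nB m m' (b, w) (b, w'))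
      ((0 : ℝ) : ℂ) := by
    intro h
    rw [Complex.ofReal_zero]
    refine hasSum_zero.congr_fun fun b => outputKernel_eq_zero η nB fun n h1 h2 => h ?_
    simp only at h1 h2
    omega
  by_cases h : w + m' = w' + m
  · obtain rfl | rfl : m = 0 ∨ m = 1 := by omega
    · obtain rfl | rfl : m' = 0 ∨ m' = 1 := by omega
      · obtain rfl : w = w' := by omega
        simpa [willieBlock] using hasSum_outputKernel_zero_zero hη0 hη1 hnB w w
      · obtain rfl : w' = w + 1 := by omega
        simpa [willieBlock, outputKernel_zero_one] using
          hasSum_outputKernel_one_zero_succ hη0 hη1 hnB w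
    · obtain rfl | rfl : m' = 0 ∨ m' = 1 := by omega
      · obtain rfl : w = w' + 1 := by omega
        simpa [willieBlock] using hasSum_outputKernel_one_zero_succ hη0 hη1 hnB w'
      · obtain rfl : w = w' := by omega
        simpa [willieBlock] using hasSum_outputKernel_one_one_self hη0 hη1 hnB w
  · simpa [willieBlock, h] using zero h

theorem dualRailBasis_le_one (i : Fin 2) : (dualRailBasis i).1 ≤ 1 ∧ (dualRailBasis i).2 ≤ 1 := by
  fin_cases i <;> simp [dualRailBasis]

theorem hasSum_willie {η nB : ℝ} (hη0 : 0 < η) (hη1 : η ≤ 1) (hnB : 0 < nB)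
    (ρ : Matrix (Fin 2) (Fin 2) ℂ) (w w' : ℕ × ℕ) :
    HasSum (fun b : ℕ × ℕ => jointOutput η nB (dualRail ρ)
        ((b.1, w.1), (b.2, w.2)) ((b.1, w'.1), (b.2, w'.2)))
      (∑ i, ∑ j, ρ i j *
        ((willieBlock η nB (dualRailBasis i).1 (dualRailBasis j).1 w.1 w'.1 : ℂ) *
          (willieBlock η nB (dualRailBasis i).2 (dualRailBasis j).2 w.2 w'.2 : ℂ))) := by
  refine HasSum.congr_fun (hasSum_sum fun i _ => hasSum_sum fun j _ => HasSum.mul_left (ρ i j)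
    (hasSum_prod_mul
      (hasSum_outputKernel_willieBlock hη0 hη1 hnB (dualRailBasis_le_one i).1
        (dualRailBasis_le_one j).1 w.1 w'.1)
      (hasSum_outputKernel_willieBlock hη0 hη1 hnB (dualRailBasis_le_one i).2
        (dualRailBasis_le_one j).2 w.2 w'.2)))
    fun b => (jointOutput_dualRail η nB ρ _ _).2

theorem willie_eq {η nB : ℝ} (hη0 : 0 < η) (hη1 : η ≤ 1) (hnB : 0 < nB)
    (ρ : Matrix (Fin 2) (Fin 2) ℂ) (w w' : ℕ × ℕ) :
    willie η nB (dualRail ρ) w w' = ∑ i, ∑ j, ρ i j *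
        ((willieBlock η nB (dualRailBasis i).1 (dualRailBasis j).1 w.1 w'.1 : ℂ) *
          (willieBlock η nB (dualRailBasis i).2 (dualRailBasis j).2 w.2 w'.2 : ℂ)) :=
  (hasSum_willie hη0 hη1 hnB ρ w w').tsum_eq

/-! ### Positivity of Willie's state -/

/-- Congruence `c • G ρ Gᴴ` preserves positivity, for a matrix `G` with arbitrarily many rows. -/
theorem posSemidef_congruence {ι κ : Type*} [Fintype κ] {ρ : Matrix κ κ ℂ} (hρ : ρ.PosSemidef)
    {c : ℝ} (hc : 0 ≤ c) (G : ι → κ → ℂ) :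
    Matrix.PosSemidef (fun x y : ι => (c : ℂ) * ∑ i, ∑ j, G x i * ρ i j * conj (G y j)) := by
  constructor
  · refine Matrix.IsHermitian.ext fun x y => ?_
    simp only [star_mul', star_sum, Complex.star_def,
      Complex.conj_ofReal, Complex.conj_conj]
    rw [Finset.sum_comm]
    congr 1
    refine Finset.sum_congr rfl fun i _ => Finset.sum_congr rfl fun j _ => ?_
    rw [← hρ.1.apply i j, Complex.star_def]
    ring
  · intro x
    have h := (Matrix.posSemidef_iff_dotProduct_mulVec.mp hρ).2
      (fun j => ∑ y ∈ x.support, conj (G y j) * x y)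
    have e : (x.sum fun i xi => x.sum fun j xj =>
        star xi * ((c : ℂ) * ∑ k, ∑ l, G i k * ρ k l * conj (G j l)) * xj) =
        (c : ℂ) * (star (fun j => ∑ y ∈ x.support, conj (G y j) * x y) ⬝ᵥ
          ρ.mulVec (fun j => ∑ y ∈ x.support, conj (G y j) * x y)) := by
      simp only [Finsupp.sum, dotProduct, Matrix.mulVec, Pi.star_apply, star_sum, star_mul',
        Complex.star_def, Complex.conj_conj, Finset.mul_sum, Finset.sum_mul]
      rw [Finset.sum_comm]
      refine Eq.trans (Finset.sum_congr rfl fun b _ => Finset.sum_comm) ?_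
      rw [Finset.sum_comm]
      refine Finset.sum_congr rfl fun k _ => ?_
      refine Eq.trans (Finset.sum_congr rfl fun b _ => Finset.sum_comm) ?_
      rw [Finset.sum_comm]
      refine Finset.sum_congr rfl fun l _ => Finset.sum_congr rfl fun b _ =>
        Finset.sum_congr rfl fun a _ => ?_
      ring
    rw [e]
    exact mul_nonneg (by exact_mod_cast hc) h

theorem thermalWeight_pos {N : ℝ} (hN : 0 < N) (k : ℕ) : 0 < thermalWeight N k := by
  unfold thermalWeight
  positivity

theorem posSemidef_willie {η nB : ℝ} (hη0 : 0 < η) (hη1 : η ≤ 1) (hnB : 0 < nB)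
    {ρ : Matrix (Fin 2) (Fin 2) ℂ} (hρ : ρ.PosSemidef) :
    (willie η nB (dualRail ρ)).PosSemidef := by
  refine posSemidef_of_hasSum
    (A := fun (b : ℕ × ℕ) (w w' : ℕ × ℕ) => jointOutput η nB (dualRail ρ)
      ((b.1, w.1), (b.2, w.2)) ((b.1, w'.1), (b.2, w'.2))) (fun b => ?_) fun w w' => ?_
  · exact posSemidef_of_hasSum
      (fun n : ℕ × ℕ => posSemidef_congruence hρ
        (mul_nonneg (thermalWeight_pos hnB n.1).le (thermalWeight_pos hnB n.2).le)
        (fun (w : ℕ × ℕ) i =>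
          (beamsplitter η ⊗ₖ beamsplitter η) ((b.1, w.1), (b.2, w.2)) (inputIndex i n)))
      fun w w' => (jointOutput_dualRail η nB ρ _ _).1
  · exact (hasSum_willie hη0 hη1 hnB ρ w w').summable.hasSum

/-! ### Moments of the thermal distribution and the trace -/

theorem thermalWeight_eq (N : ℝ) (k : ℕ) :
    thermalWeight N k = 1 / (1 + N) * (N / (1 + N)) ^ k := by
  unfold thermalWeight
  rw [div_pow, pow_succ]
  generalize 1 + N = D
  ring

theorem hasSum_thermalWeight {N : ℝ} (hN : 0 < N) : HasSum (thermalWeight N) 1 := by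
  have hr1 : N / (1 + N) < 1 := by rw [div_lt_one (by positivity)]; linarith
  have h := (hasSum_choose_mul_pow 0 (by positivity) hr1).mul_left (1 / (1 + N))
  have hval : 1 / (1 + N) * (1 / (1 - N / (1 + N)) ^ (0 + 1)) = 1 := by
    have hD : 1 + N ≠ 0 := by positivity
    rw [one_sub_div hD, add_sub_cancel_right]
    simp only [zero_add, pow_one]
    field_simp
  rw [hval] at h
  exact h.congr_fun fun k => by simp [thermalWeight_eq]

theorem hasSum_mul_thermalWeight {N : ℝ} (hN : 0 < N) :
    HasSum (fun k : ℕ => k * thermalWeight N k) N := by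
  have hr1 : N / (1 + N) < 1 := by rw [div_lt_one (by positivity)]; linarith
  have h := (hasSum_mul_choose_mul_pow 0 (by positivity) hr1).mul_left (1 / (1 + N) * (N / (1 + N)))
  have hval : 1 / (1 + N) * (N / (1 + N)) *
      (((0 : ℕ) + 1) / (1 - N / (1 + N)) ^ (0 + 2)) = N := by
    have hD : 1 + N ≠ 0 := by positivity
    rw [one_sub_div hD, add_sub_cancel_right]
    simp only [zero_add, Nat.cast_zero]
    field_simp
  rw [hval] at h
  refine h.congr_fun fun k => ?_
  rcases k with - | k
  · simp
  · simp only [thermalWeight_eq, add_zero, Nat.choose_zero_right, Nat.add_sub_cancel, pow_succ]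
    push_cast
    ring

theorem hasSum_sq_mul_thermalWeight {N : ℝ} (hN : 0 < N) :
    HasSum (fun k : ℕ => (k : ℝ) ^ 2 * thermalWeight N k) (N + 2 * N ^ 2) := by
  have hr1 : N / (1 + N) < 1 := by rw [div_lt_one (by positivity)]; linarith
  have h := (hasSum_sq_mul_choose_mul_pow 0 (by positivity) hr1).mul_left
    (1 / (1 + N) * (N / (1 + N)))
  have hval : 1 / (1 + N) * (N / (1 + N)) * (((0 : ℕ) + 1) * (1 / (1 - N / (1 + N)) ^ (0 + 2) +
      N / (1 + N) * (((0 : ℕ) + 2) / (1 - N / (1 + N)) ^ (0 + 3)))) = N + 2 * N ^ 2 := by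
    have hD : 1 + N ≠ 0 := by positivity
    rw [one_sub_div hD, add_sub_cancel_right]
    simp only [zero_add, Nat.cast_zero]
    field_simp
  rw [hval] at h
  refine h.congr_fun fun k => ?_
  rcases k with - | k
  · simp
  · simp only [thermalWeight_eq, add_zero, Nat.choose_zero_right, Nat.add_sub_cancel, pow_succ]
    push_cast
    ring

theorem hasSum_onePhotonWeight {η nB : ℝ} (hη0 : 0 < η) (hnB : 0 < nB) :
    HasSum (onePhotonWeight η nB) 1 := by
  have hM : 0 < η * nB := mul_pos hη0 hnB
  have h := (hasSum_thermalWeight hM).add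
    (((hasSum_mul_thermalWeight hM).sub ((hasSum_thermalWeight hM).mul_left (η * nB))).mul_left
      ((1 - η) / (η * nB * (1 + η * nB))))
  rw [mul_one, sub_self, mul_zero, add_zero] at h
  exact h.congr_fun fun k => by unfold onePhotonWeight; ring

theorem hasTrace_willie {η nB : ℝ} (hη0 : 0 < η) (hη1 : η ≤ 1) (hnB : 0 < nB)
    (ρ : Matrix (Fin 2) (Fin 2) ℂ) :
    HasTrace (willie η nB (dualRail ρ)) ρ.trace := by
  have hM : 0 < η * nB := mul_pos hη0 hnB
  have h0 := Complex.hasSum_ofReal.mpr (hasSum_thermalWeight hM)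
  have h1 := Complex.hasSum_ofReal.mpr (hasSum_onePhotonWeight hη0 hnB)
  have h := ((hasSum_prod_mul h0 h1).mul_left (ρ 0 0)).add
    ((hasSum_prod_mul h1 h0).mul_left (ρ 1 1))
  simp only [Complex.ofReal_one, mul_one] at h
  rw [Matrix.trace_fin_two]
  refine h.congr_fun fun w => ?_
  rw [willie_eq hη0 hη1 hnB]
  simp [Fin.sum_univ_two, dualRailBasis, willieBlock]

/-! ### The chi-squared divergence -/

theorem kronecker_thermal (N : ℝ) :
    Matrix.kronecker (thermal N) (thermal N) =
      Matrix.diagonal fun w : ℕ × ℕ => ((thermalWeight N w.1 * thermalWeight N w.2 : ℝ) : ℂ) := by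
  unfold thermal
  refine (Matrix.diagonal_kronecker_diagonal _ _).trans ?_
  congr 1
  funext w
  rw [thermalWeight, thermalWeight]
  push_cast
  rfl

/-- The diagonal entries of the difference between Willie's output and the thermal background, for
populations `a` of `|01⟩` and `b` of `|10⟩`. -/
def diagDeviation (η nB a b : ℝ) (w : ℕ × ℕ) : ℝ :=
  (1 - η) / (η * nB * (1 + η * nB)) * (thermalWeight (η * nB) w.1 * thermalWeight (η * nB) w.2) *
    (a * (w.2 - η * nB) + b * (w.1 - η * nB))

/-- The deviation from the background: as `a + b = 1`, the thermal parts cancel on the diagonal; the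
off-diagonal entries come from `γ |01⟩⟨10|` and its adjoint. -/
theorem willie_sub_thermal {η nB : ℝ} (hη0 : 0 < η) (hη1 : η ≤ 1) (hnB : 0 < nB) {a b : ℝ}
    (hab : a + b = 1) (γ : ℂ) (w k : ℕ × ℕ) :
    (willie η nB (dualRail !![(a : ℂ), γ; conj γ, (b : ℂ)]) -
        Matrix.kronecker (thermal (η * nB)) (thermal (η * nB))) w k =
      (if k = w then (diagDeviation η nB a b w : ℂ) else 0) +
      (if k.1 = w.1 + 1 ∧ w.2 = k.2 + 1 then γ * coherence η nB w.1 * coherence η nB k.2 else 0) +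
      (if w.1 = k.1 + 1 ∧ k.2 = w.2 + 1 then
        conj γ * coherence η nB k.1 * coherence η nB w.2 else 0) := by
  obtain ⟨w₁, w₂⟩ := w
  obtain ⟨k₁, k₂⟩ := k
  rw [Matrix.sub_apply, willie_eq hη0 hη1 hnB, kronecker_thermal, Matrix.diagonal_apply]
  simp only [Fin.sum_univ_two, dualRailBasis, willieBlock, Prod.mk.injEq, Matrix.cons_val_zero,
    Matrix.cons_val_one, Matrix.of_apply, Matrix.cons_val', Matrix.cons_val_fin_one, add_zero,
    one_ne_zero, if_true, if_false, add_left_inj]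
  by_cases h1 : w₁ = k₁
  · by_cases h2 : w₂ = k₂
    · subst h1 h2
      simp [onePhotonWeight, diagDeviation]
      have hb : (b : ℂ) = 1 - a := by
        rw [eq_sub_iff_add_eq', ← Complex.ofReal_add, hab, Complex.ofReal_one]
      rw [hb]
      ring
    · subst h1
      simp [h2, Ne.symm h2]
  · by_cases h3 : k₁ = w₁ + 1
    · subst h3
      by_cases h4 : w₂ = k₂ + 1
      · subst h4
        have e1 : ¬ w₁ = w₁ + 1 + 1 := by omega
        have e2 : ¬ k₂ = k₂ + 1 + 1 := by omega
        simp [e1, e2]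
        ring
      · have e1 : ¬ w₁ = w₁ + 1 + 1 := by omega
        simp [h4, e1]
    · by_cases h5 : w₁ = k₁ + 1
      · subst h5
        have e1 : ¬ k₁ + 1 + 1 = k₁ := by omega
        by_cases h6 : k₂ = w₂ + 1
        · subst h6
          simp [h3, e1]
          ring
        · simp [h3, e1, h6, Ne.symm h6]
      · simp [h1, h3, Ne.symm h3, h5, Ne.symm h1]

/-- The sequence `f` delayed by one step, with value zero at zero; this avoids `f (n - 1)`. -/
def lowered (f : ℕ → ℝ) : ℕ → ℝ
  | 0 => 0
  | n + 1 => f n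

theorem hasSum_lowered (f : ℕ → ℝ) (n : ℕ) :
    HasSum (fun k => if n = k + 1 then f k else 0) (lowered f n) := by
  rcases n with - | n
  · simp [lowered, hasSum_zero]
  · have h := hasSum_single n (f := fun k => if n + 1 = k + 1 then f k else 0)
      fun k hk => if_neg fun h => hk (Nat.succ_injective h).symm
    rwa [if_pos rfl] at h

/-- The diagonal of `Δ²` for a Hermitian `Δ` whose off-diagonal entries move one photon between the
modes: only the entries `(w, w)`, `(w, w + (1, -1))` and `(w, w + (-1, 1))` contribute. -/
theorem opMul_self_diag {Δ : Matrix (ℕ × ℕ) (ℕ × ℕ) ℂ} {δ : ℕ × ℕ → ℝ} {c : ℕ → ℝ} {γ : ℂ}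
    (hΔ : ∀ w k, Δ w k = (if k = w then (δ w : ℂ) else 0) +
      (if k.1 = w.1 + 1 ∧ w.2 = k.2 + 1 then γ * c w.1 * c k.2 else 0) +
      (if w.1 = k.1 + 1 ∧ k.2 = w.2 + 1 then conj γ * c k.1 * c w.2 else 0)) (w : ℕ × ℕ) :
    opMul Δ Δ w w = ((δ w ^ 2 + ‖γ‖ ^ 2 * (c w.1 ^ 2 * lowered (fun k => c k ^ 2) w.2 +
      lowered (fun k => c k ^ 2) w.1 * c w.2 ^ 2) : ℝ) : ℂ) := by
  have hs := (hasSum_ite_eq w (δ w ^ 2)).add (((hasSum_prod_mul (hasSum_ite_eq (w.1 + 1) (c w.1 ^ 2))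
    (hasSum_lowered (fun k => c k ^ 2) w.2)).add
    (hasSum_prod_mul (hasSum_lowered (fun k => c k ^ 2) w.1)
      (hasSum_ite_eq (w.2 + 1) (c w.2 ^ 2)))).mul_left (‖γ‖ ^ 2))
  refine ((Complex.hasSum_ofReal.mpr hs).congr_fun fun k => ?_).tsum_eq
  have hγ : γ * conj γ = ((‖γ‖ ^ 2 : ℝ) : ℂ) := by
    rw [Complex.mul_conj, Complex.normSq_eq_norm_sq]
  rw [hΔ, hΔ]
  obtain ⟨w₁, w₂⟩ := w
  obtain ⟨k₁, k₂⟩ := k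
  simp only [Prod.mk.injEq]
  by_cases h1 : w₁ = k₁
  · by_cases h2 : w₂ = k₂
    · subst h1 h2
      simp
      ring
    · simp [h1, h2, Ne.symm h2]
  · by_cases h3 : k₁ = w₁ + 1
    · subst h3
      have e1 : ¬ w₁ = w₁ + 1 + 1 := by omega
      by_cases h4 : w₂ = k₂ + 1
      · subst h4
        simp [e1]
        push_cast at hγ
        linear_combination ((c w₁ : ℂ) ^ 2 * (c k₂ : ℂ) ^ 2) * hγ
      · simp [h4, e1]
    · by_cases h5 : w₁ = k₁ + 1
      · subst h5
        by_cases h6 : k₂ = w₂ + 1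
        · subst h6
          simp [h3]
          push_cast at hγ
          linear_combination ((c k₁ : ℂ) ^ 2 * (c w₂ : ℂ) ^ 2) * hγ
        · simp [h3, h6]
      · simp [h1, h3, h5, Ne.symm h1]

/-- The trace of the divergence. The diagonal part contributes the variances of the photon numbers,
the mixed covariance being zero by independence of the modes; the coherences contribute `2 g`, where
`g = ‖γ‖ ^ 2`. -/
theorem hasSum_chiSq {η nB : ℝ} (hη0 : 0 < η) (hη1 : η ≤ 1) (hnB : 0 < nB) (a b g : ℝ) :
    HasSum (fun w : ℕ × ℕ => (diagDeviation η nB a b w ^ 2 + g *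
        (coherence η nB w.1 ^ 2 * lowered (fun k => coherence η nB k ^ 2) w.2 +
          lowered (fun k => coherence η nB k ^ 2) w.1 * coherence η nB w.2 ^ 2)) *
        (thermalWeight (η * nB) w.1 * thermalWeight (η * nB) w.2)⁻¹)
      ((1 - η) ^ 2 / (η * nB * (1 + η * nB)) * (a ^ 2 + b ^ 2 + 2 * g)) := by
  have hM : 0 < η * nB := mul_pos hη0 hnB
  have hcoh : ∀ k, coherence η nB k ^ 2 =
      (1 - η) / (1 + η * nB) ^ 2 * ((k + 1) * thermalWeight (η * nB) k ^ 2) := by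
    intro k
    rw [coherence, mul_pow, mul_pow, div_pow, Real.sq_sqrt (by linarith),
      Real.sq_sqrt (by positivity)]
    ring
  have hlow : ∀ k : ℕ, lowered (fun k => coherence η nB k ^ 2) k =
      (1 - η) / (η * nB) ^ 2 * (k * thermalWeight (η * nB) k ^ 2) := by
    intro k
    rcases k with - | k
    · simp [lowered]
    · have : thermalWeight (η * nB) (k + 1) =
          thermalWeight (η * nB) k * (η * nB / (1 + η * nB)) := by
        unfold thermalWeight
        rw [pow_succ, pow_succ _ (k + 1)]
        field_simp
      rw [lowered, hcoh, this]
      push_cast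
      field_simp
  simp only [hlow, diagDeviation]
  simp only [hcoh]
  generalize η * nB = M at hM
  have m0 := hasSum_thermalWeight hM
  have m1 := hasSum_mul_thermalWeight hM
  have m2 := hasSum_sq_mul_thermalWeight hM
  -- The square of the diagonal deviation, expanded into products of moments of the two modes.
  have h := ((((((hasSum_prod_mul m0 m2).mul_left (a ^ 2)).add
    ((hasSum_prod_mul m2 m0).mul_left (b ^ 2))).add
    ((hasSum_prod_mul m1 m1).mul_left (2 * a * b))).add
    ((hasSum_prod_mul m0 m1).mul_left (-2 * M * a * (a + b)))).add
    ((hasSum_prod_mul m1 m0).mul_left (-2 * M * b * (a + b)))).add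
    ((hasSum_prod_mul m0 m0).mul_left (M ^ 2 * (a + b) ^ 2))
  have h' := (h.mul_left (((1 - η) / (M * (1 + M))) ^ 2)).add
    ((((hasSum_prod_mul m1 m1).mul_left 2).add
      ((hasSum_prod_mul m0 m1).add (hasSum_prod_mul m1 m0))).mul_left
        (g * ((1 - η) / (1 + M) ^ 2) * ((1 - η) / M ^ 2)))
  have hval : (1 - η) ^ 2 / (M * (1 + M)) * (a ^ 2 + b ^ 2 + 2 * g) = ((1 - η) / (M * (1 + M))) ^ 2 *
      (a ^ 2 * (1 * (M + 2 * M ^ 2)) + b ^ 2 * ((M + 2 * M ^ 2) * 1) + 2 * a * b * (M * M) +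
        -2 * M * a * (a + b) * (1 * M) + -2 * M * b * (a + b) * (M * 1) +
        M ^ 2 * (a + b) ^ 2 * (1 * 1)) +
      g * ((1 - η) / (1 + M) ^ 2) * ((1 - η) / M ^ 2) * (2 * (M * M) + (1 * M + M * 1)) := by
    field_simp
    ring
  rw [hval]
  refine h'.congr_fun fun w => ?_
  have p1 := (thermalWeight_pos hM w.1).ne'
  have p2 := (thermalWeight_pos hM w.2).ne'
  field_simp
  ring

theorem hasChiSqDiv_willie {η nB : ℝ} (hη0 : 0 < η) (hη1 : η ≤ 1) (hnB : 0 < nB) {a b : ℝ}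
    (hab : a + b = 1) (γ : ℂ) :
    HasChiSqDiv (willie η nB (dualRail !![(a : ℂ), γ; conj γ, (b : ℂ)]))
      (Matrix.kronecker (thermal (η * nB)) (thermal (η * nB)))
      ((1 - η) ^ 2 / (η * nB * (1 + η * nB)) * (a ^ 2 + b ^ 2 + 2 * ‖γ‖ ^ 2)) := by
  have hM : 0 < η * nB := mul_pos hη0 hnB
  refine ⟨Matrix.diagonal fun w : ℕ × ℕ =>
    ((thermalWeight (η * nB) w.1 * thermalWeight (η * nB) w.2 : ℝ) : ℂ)⁻¹, ?_, ?_⟩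
  · rw [kronecker_thermal]
    refine (isInverse_diagonal_iff _ (fun w => ?_) _).mpr rfl
    exact_mod_cast (mul_pos (thermalWeight_pos hM w.1) (thermalWeight_pos hM w.2)).ne'
  · refine (Complex.hasSum_ofReal.mpr
      (hasSum_chiSq hη0 hη1 hnB a b (‖γ‖ ^ 2))).congr_fun fun w => ?_
    rw [opMul, tsum_eq_single w fun k hk => by rw [Matrix.diagonal_apply_ne _ hk, mul_zero],
      Matrix.diagonal_apply_eq,
      opMul_self_diag (willie_sub_thermal hη0 hη1 hnB hab γ)]
    push_cast
    rfl

end DualRail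

end

theorem lemma3 (η nB : ℝ) (hη0 : 0 < η) (hη1 : η ≤ 1) (hnB : 0 < nB)
    (α β γ : ℂ) (hρ : DualRail.IsDensity (DualRail.logical α β γ)) :
    DualRail.IsDensity (DualRail.willie η nB (DualRail.dualRail (DualRail.logical α β γ))) ∧
    ∃ d : ℝ,
      DualRail.HasChiSqDiv (DualRail.willie η nB (DualRail.dualRail (DualRail.logical α β γ)))
        (Matrix.kronecker (DualRail.thermal (η * nB)) (DualRail.thermal (η * nB))) d ∧
      d ≤ (1 - η) ^ 2 / (η * nB * (1 + η * nB)) ∧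
      (‖γ‖ = ‖α‖ * ‖β‖ → d = (1 - η) ^ 2 / (η * nB * (1 + η * nB))) := by
  have htr : (DualRail.logical α β γ).trace = 1 :=
    (hasSum_fintype fun i => DualRail.logical α β γ i i).unique hρ.2
  have hab : ‖α‖ ^ 2 + ‖β‖ ^ 2 = 1 := by
    rw [Matrix.trace_fin_two] at htr
    simp only [DualRail.logical, Matrix.of_apply, Matrix.cons_val', Matrix.cons_val_zero,
      Matrix.cons_val_one, Matrix.cons_val_fin_one] at htr
    exact_mod_cast htr
  have hdet : ‖γ‖ ^ 2 ≤ ‖α‖ ^ 2 * ‖β‖ ^ 2 := by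
    have h := hρ.1.det_nonneg
    rw [DualRail.logical, Matrix.det_fin_two_of, Complex.mul_conj, Complex.normSq_eq_norm_sq] at h
    have h' : (0 : ℝ) ≤ ‖α‖ ^ 2 * ‖β‖ ^ 2 - ‖γ‖ ^ 2 := by exact_mod_cast h
    linarith
  refine ⟨⟨DualRail.posSemidef_willie hη0 hη1 hnB hρ.1, ?_⟩, _,
    DualRail.hasChiSqDiv_willie hη0 hη1 hnB hab γ, ?_, fun hγ => ?_⟩
  · have h := DualRail.hasTrace_willie hη0 hη1 hnB (DualRail.logical α β γ)
    rwa [htr] at h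
  · refine mul_le_of_le_one_right (by positivity) ?_
    nlinarith
  · rw [hγ, show (‖α‖ ^ 2) ^ 2 + (‖β‖ ^ 2) ^ 2 + 2 * (‖α‖ * ‖β‖) ^ 2 = (‖α‖ ^ 2 + ‖β‖ ^ 2) ^ 2 by ring,
      hab, one_pow, mul_one]
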